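/- Let $n\ge 2$, let $\mathcal E$ be a complex Hilbert space, and let $H^2(\mathbb D^n)\otimes\mathcal E$ be the $\mathcal E$-valued Hardy space over the open unit polydisc $\mathbb D^n\subset\mathbb C^n$, that is, the reproducing kernel Hilbert space of $\mathcal E$-valued functions on $\mathbb D^n$ with kernel $g(z,w)I_{\mathcal E}$, where $g(z,w)=\prod_{i=1}^n(1-z_i\bar w_i)^{-1}$; let $M_{z_i}$ denote multiplication by the $i$-th coordinate function. A submodule $\mathcal S$ is a closed subspace of $H^2(\mathbb D^n)\otimes\mathcal E$ with $M_{z_i}\mathcal S\subseteq\mathcal S$ for $i=1,\dots,n$; put $R_{z_i}=M_{z_i}|_{\mathcal S}\in\mathcal B(\mathcal S)$. The submodule $\mathcal S$ is called a Brehmer submodule if $$g^{-1}(R_z,R_z^*)=\sum_{\mathbf k,\mathbf l}a_{\mathbf k\mathbf l}\,R_z^{\mathbf k}R_z^{*\mathbf l}\ \ge 0,$$ where $g^{-1}(z,w)=\prod_{i=1}^n(1-z_i\bar w_i)=\sum_{\mathbf k,\mathbf l}a_{\mathbf k\mathbf l}z^{\mathbf k}\bar w^{\mathbf l}$ (a finite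 sum over multi-indices), and it is called doubly commuting if $R_{z_i}^*R_{z_j}-R_{z_j}R_{z_i}^*=0$ for all $1\le i\ne j\le n$. Theorem. A submodule $\mathcal S$ of $H^2(\mathbb D^n)\otimes\mathcal E$ is a Brehmer submodule if and only if it is doubly commuting. -/

import Mathlib

noncomputable section

namespace PolydiscHardy

open scoped InnerProductSpace ComplexConjugate ENNReal

/-- The open unit polydisc `𝔻ⁿ` in `ℂⁿ`. -/
def polydisc (n : ℕ) : Set (Fin n → ℂ) := {z | ∀ i, ‖z i‖ < 1}

/-- The monomial `z^k = z₁^k₁ ⋯ zₙ^kₙ`. -/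
def monom {n : ℕ} (z : Fin n → ℂ) (k : Fin n → ℕ) : ℂ := ∏ i, z i ^ k i

/-- The Szegő kernel `∏ᵢ (1 - zᵢ w̄ᵢ)⁻¹` of the polydisc. -/
def szegoKernel {n : ℕ} (z w : Fin n → ℂ) : ℂ := ∏ i, (1 - z i * conj (w i))⁻¹

/-- The `E`-valued Hardy space `H²(𝔻ⁿ) ⊗ E`: the `E`-valued functions `f(z) = ∑ₖ zᵏ aₖ` on the
polydisc with `‖f‖² = ∑ₖ ‖aₖ‖² < ∞`. The carrier records the Taylor coefficients; the instance
`instRKHS` below makes its elements into functions on `𝔻ⁿ`, and `kernel_eq` shows that it is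
the reproducing kernel Hilbert space of functions `𝔻ⁿ → E` whose kernel is the Szegő kernel times
the identity of `E`. -/
def HardySpace (n : ℕ) (E : Type*) [NormedAddCommGroup E] [InnerProductSpace ℂ E] : Type _ :=
  lp (fun _ : Fin n → ℕ => E) 2

section Basic

variable {n : ℕ} {E : Type*} [NormedAddCommGroup E] [InnerProductSpace ℂ E]

instance : NormedAddCommGroup (HardySpace n E) :=
  inferInstanceAs (NormedAddCommGroup (lp (fun _ : Fin n → ℕ => E) 2))

instance : InnerProductSpace ℂ (HardySpace n E) :=
  inferInstanceAs (InnerProductSpace ℂ (lp (fun _ : Fin n → ℕ => E) 2))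

instance [CompleteSpace E] : CompleteSpace (HardySpace n E) :=
  inferInstanceAs (CompleteSpace (lp (fun _ : Fin n → ℕ => E) 2))

/-- The `k`-th Taylor coefficient of an element of the Hardy space. -/
def HardySpace.coeff (f : HardySpace n E) (k : Fin n → ℕ) : E :=
  (show lp (fun _ : Fin n → ℕ => E) 2 from f) k

/-- The element of the Hardy space with a given square summable family of Taylor coefficients. -/
def HardySpace.mk (a : (Fin n → ℕ) → E) (ha : Summable fun k => ‖a k‖ ^ 2) : HardySpace n E :=
  show lp (fun _ : Fin n → ℕ => E) 2 from
    ⟨a, memℓp_gen (by simpa using ha)⟩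

@[simp] lemma coeff_mk (a : (Fin n → ℕ) → E) (ha : Summable fun k => ‖a k‖ ^ 2) (k : Fin n → ℕ) :
    (HardySpace.mk a ha).coeff k = a k := rfl

lemma coeff_ext {f g : HardySpace n E} (h : ∀ k, f.coeff k = g.coeff k) : f = g :=
  lp.ext (funext h)

@[simp] lemma coeff_add (f g : HardySpace n E) (k : Fin n → ℕ) :
    (f + g).coeff k = f.coeff k + g.coeff k := rfl

@[simp] lemma coeff_smul (c : ℂ) (f : HardySpace n E) (k : Fin n → ℕ) :
    (c • f).coeff k = c • f.coeff k := rfl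

lemma inner_eq_tsum (f g : HardySpace n E) :
    ⟪f, g⟫_ℂ = ∑' k, ⟪f.coeff k, g.coeff k⟫_ℂ := rfl

lemma hasSum_norm_sq (f : HardySpace n E) : HasSum (fun k => ‖f.coeff k‖ ^ 2) (‖f‖ ^ 2) := by
  have := lp.hasSum_norm (p := 2) (by norm_num)
    (show lp (fun _ : Fin n → ℕ => E) 2 from f)
  simp only [ENNReal.toReal_ofNat, Real.rpow_two] at this
  exact this

end Basic

section Series

lemma hasSum_monom {n : ℕ} (z : Fin n → ℂ) (hz : ∀ i, ‖z i‖ < 1) :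
    (Summable fun k : Fin n → ℕ => ‖monom z k‖) ∧ HasSum (monom z) (∏ i, (1 - z i)⁻¹) := by
  induction n with
  | zero =>
    refine ⟨(hasSum_fintype _).summable, ?_⟩
    have h := hasSum_unique (monom z)
    simpa only [monom, Finset.univ_eq_empty, Finset.prod_empty] using h
  | succ n ih =>
    obtain ⟨h1, h2⟩ := ih (fun i => z i.succ) (fun i => hz _)
    have h0 := hasSum_geometric_of_norm_lt_one (hz 0)
    have h0' : Summable fun m : ℕ => ‖z 0 ^ m‖ := by
      simpa using summable_geometric_of_lt_one (norm_nonneg _) (hz 0)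
    have key : ∀ p : ℕ × (Fin n → ℕ), monom z (Fin.consEquiv (fun _ => ℕ) p) =
        z 0 ^ p.1 * monom (fun i => z i.succ) p.2 := by
      intro p
      simp [monom, Fin.prod_univ_succ, Fin.consEquiv]
    have hs := h0'.mul_norm h1
    constructor
    · rw [← (Fin.consEquiv (fun _ => ℕ)).summable_iff]
      simpa [Function.comp_def, key] using hs
    · rw [← (Fin.consEquiv (fun _ => ℕ)).hasSum_iff, Fin.prod_univ_succ]
      simp only [Function.comp_def, key]
      exact h0.mul h2 hs.of_norm

lemma summable_norm_monom_sq {n : ℕ} {z : Fin n → ℂ} (hz : z ∈ polydisc n) :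
    Summable fun k : Fin n → ℕ => ‖monom z k‖ ^ 2 := by
  have h := (hasSum_monom (fun i => z i ^ 2) (fun i => by
    rw [norm_pow]; exact pow_lt_one₀ (norm_nonneg _) (hz i) two_ne_zero)).1
  refine h.congr fun k => ?_
  simp only [monom, norm_prod, norm_pow, ← Finset.prod_pow]
  refine Finset.prod_congr rfl fun i _ => ?_
  ring

variable {E : Type*} [NormedAddCommGroup E] [InnerProductSpace ℂ E]

/-- A family of coefficients whose power series converges absolutely to `0` on the polydisc
vanishes. -/
lemma coeff_eq_zero [CompleteSpace E] {n : ℕ} (a : (Fin n → ℕ) → E)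
    (hs : ∀ z ∈ polydisc n, Summable fun k => ‖monom z k • a k‖)
    (h0 : ∀ z ∈ polydisc n, ∑' k, monom z k • a k = 0) : a = 0 := by
  induction n with
  | zero =>
    ext k
    have := h0 0 (fun i => i.elim0)
    rw [tsum_eq_single k (fun b hb => absurd (Subsingleton.elim b k) hb)] at this
    simpa [monom] using this
  | succ n ih =>
    have key : ∀ (x : ℂ) (z : Fin n → ℂ) (p : ℕ × (Fin n → ℕ)),
        monom (Fin.cons x z : Fin (n + 1) → ℂ) (Fin.consEquiv (fun _ => ℕ) p) =
        x ^ p.1 * monom z p.2 := by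
      intro x z p
      simp [monom, Fin.prod_univ_succ, Fin.consEquiv]
    have hmem : ∀ (x : ℂ) (z : Fin n → ℂ), ‖x‖ < 1 → z ∈ polydisc n →
        (Fin.cons x z : Fin (n + 1) → ℂ) ∈ polydisc (n + 1) := by
      intro x z hx hz i
      refine Fin.cases ?_ (fun j => ?_) i
      · simpa using hx
      · simpa using hz j
    have hsum : ∀ (x : ℂ) (z : Fin n → ℂ), ‖x‖ < 1 → z ∈ polydisc n →
        Summable fun p : ℕ × (Fin n → ℕ) => ‖(x ^ p.1 * monom z p.2) •
          a (Fin.consEquiv (fun _ => ℕ) p)‖ := by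
      intro x z hx hz
      have := (Fin.consEquiv (fun _ : Fin (n + 1) => ℕ)).summable_iff.2 (hs _ (hmem x z hx hz))
      simpa only [Function.comp_def, key] using this
    have hslice : ∀ (z : Fin n → ℂ), z ∈ polydisc n → ∀ m : ℕ,
        Summable fun k => ‖monom z k • a (Fin.consEquiv (fun _ => ℕ) (m, k))‖ := by
      intro z hz m
      have h := (hsum (1 / 2) z (by norm_num) hz).comp_injective
        (i := fun k : Fin n → ℕ => (m, k)) (fun k l h => (Prod.ext_iff.1 h).2)
      have h' := h.mul_left ((2 : ℝ) ^ m)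
      refine h'.congr fun k => ?_
      have h2 : (2 : ℝ) ^ m * ‖(1 / 2 : ℂ) ^ m‖ = 1 := by
        rw [norm_pow, ← mul_pow]
        norm_num
      simp only [Function.comp_def, norm_smul, norm_mul]
      rw [← mul_assoc, ← mul_assoc, h2, one_mul]
    have hcoef : ∀ m : ℕ, (fun k => a (Fin.consEquiv (fun _ => ℕ) (m, k))) = 0 := by
      intro m
      refine ih _ (fun z hz => hslice z hz m) (fun z hz => ?_)
      let b : ℕ → E := fun m => ∑' k, monom z k • a (Fin.consEquiv (fun _ => ℕ) (m, k))
      let p : FormalMultilinearSeries ℂ ℂ E :=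
        fun m => ContinuousMultilinearMap.mkPiRing ℂ (Fin m) (b m)
      have hp : HasFPowerSeriesAt (fun _ : ℂ => (0 : E)) p 0 := by
        rw [hasFPowerSeriesAt_iff]
        filter_upwards [Metric.ball_mem_nhds (0 : ℂ) one_pos] with x hx
        have hx' : ‖x‖ < 1 := by simpa using hx
        have hS := (hsum x z hx' hz).of_norm
        have hT : ∑' q : ℕ × (Fin n → ℕ), (x ^ q.1 * monom z q.2) •
            a (Fin.consEquiv (fun _ => ℕ) q) = 0 := by
          rw [← h0 _ (hmem x z hx' hz), ← (Fin.consEquiv (fun _ : Fin (n + 1) => ℕ)).tsum_eq]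
          simp only [key]
        have h1 := hS.hasSum
        rw [hT] at h1
        refine (h1.prod_fiberwise (g := fun m => x ^ m • b m) fun m => ?_).congr_fun ?_
        · have := ((hslice z hz m).of_norm.hasSum).const_smul (x ^ m)
          simpa only [smul_smul] using this
        · intro m
          simp [p, FormalMultilinearSeries.coeff]
      have := hp.eq_zero
      have hm : p m = 0 := by rw [this]; rfl
      exact (ContinuousMultilinearMap.mkPiRing_eq_zero_iff _).1 hm
    ext k
    have := congrFun (hcoef (k 0)) (Fin.tail k)
    simpa [Fin.consEquiv] using this

end Series

section Functions

variable {n : ℕ} {E : Type*} [NormedAddCommGroup E] [InnerProductSpace ℂ E]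

lemma holder_two : (2 : ℝ).HolderConjugate 2 :=
  Real.holderConjugate_iff.2 ⟨by norm_num, by norm_num⟩

lemma eval_bound (f : HardySpace n E) {z : Fin n → ℂ} (hz : z ∈ polydisc n) :
    (Summable fun k => ‖monom z k • f.coeff k‖) ∧
      ∑' k, ‖monom z k • f.coeff k‖ ≤ (∑' k : Fin n → ℕ, ‖monom z k‖ ^ 2) ^ (1 / 2 : ℝ) * ‖f‖ := by
  have h := Real.summable_and_inner_le_Lp_mul_Lq_tsum_of_nonneg holder_two
    (f := fun k => ‖monom z k‖) (g := fun k => ‖f.coeff k‖)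
    (fun k => norm_nonneg _) (fun k => norm_nonneg _)
    (by simpa using summable_norm_monom_sq hz) (by simpa using (hasSum_norm_sq f).summable)
  simp only [norm_smul]
  refine ⟨h.1, h.2.trans (le_of_eq ?_)⟩
  simp only [Real.rpow_two, (hasSum_norm_sq f).tsum_eq]
  congr 1
  rw [← Real.sqrt_eq_rpow, Real.sqrt_sq (norm_nonneg _)]

/-- Point evaluation `f ↦ f(z) = ∑ₖ zᵏ aₖ` at a point of the polydisc. -/
def evalCLM [CompleteSpace E] (z : polydisc n) : HardySpace n E →L[ℂ] E :=
  LinearMap.mkContinuous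
    { toFun := fun f => ∑' k, monom z.1 k • f.coeff k
      map_add' := fun f g => by
        simp only [coeff_add, smul_add]
        exact (eval_bound f z.2).1.of_norm.tsum_add (eval_bound g z.2).1.of_norm
      map_smul' := fun c f => by
        simp only [coeff_smul, RingHom.id_apply, smul_comm _ c]
        exact (eval_bound f z.2).1.of_norm.tsum_const_smul c }
    ((∑' k : Fin n → ℕ, ‖monom z.1 k‖ ^ 2) ^ (1 / 2 : ℝ))
    (fun f => (norm_tsum_le_tsum_norm (eval_bound f z.2).1).trans (eval_bound f z.2).2)

/-- The Hardy space as a Hilbert space of `E`-valued functions on the polydisc. -/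
instance instRKHS [CompleteSpace E] : RKHS ℂ (HardySpace n E) (polydisc n) E where
  coeCLM := ContinuousLinearMap.pi evalCLM
  coeCLM_injective := by
    refine (injective_iff_map_eq_zero _).2 fun f hf => ?_
    have := coeff_eq_zero f.coeff (fun z hz => (eval_bound f hz).1)
      (fun z hz => congrFun hf ⟨z, hz⟩)
    exact coeff_ext fun k => congrFun this k

lemma apply_eq_tsum [CompleteSpace E] (f : HardySpace n E) (z : polydisc n) :
    f z = ∑' k, monom z.1 k • f.coeff k := rfl

/-- The reproducing kernel of `H²(𝔻ⁿ) ⊗ E` is the Szegő kernel times the identity of `E`. -/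
theorem kernel_eq [CompleteSpace E] (z w : polydisc n) :
    RKHS.kernel (HardySpace n E) z w = szegoKernel z.1 w.1 • ContinuousLinearMap.id ℂ E := by
  ext η
  have hs : Summable fun k => ‖conj (monom w.1 k) • η‖ ^ 2 := by
    simpa [norm_smul, mul_pow] using (summable_norm_monom_sq w.2).mul_right (‖η‖ ^ 2)
  have hk : RKHS.kerFun (HardySpace n E) w η = HardySpace.mk _ hs := by
    refine ext_inner_right ℂ fun f => ?_
    rw [RKHS.kerFun_inner, inner_eq_tsum, apply_eq_tsum]
    have := ((eval_bound f w.2).1.of_norm.hasSum).mapL (innerSL ℂ η)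
    simp only [innerSL_apply_apply] at this
    rw [← this.tsum_eq]
    refine tsum_congr fun k => ?_
    rw [coeff_mk, inner_smul_left, inner_smul_right, RCLike.conj_conj]
  rw [← RKHS.kerFun_apply, hk, apply_eq_tsum]
  have h := (hasSum_monom (fun i => z.1 i * conj (w.1 i)) (fun i => by
    rw [norm_mul, RCLike.norm_conj]
    exact mul_lt_one_of_nonneg_of_lt_one_left (norm_nonneg _) (z.2 i) (w.2 i).le)).2
  have h' := h.smul_const η
  simp only [coeff_mk, smul_apply, ContinuousLinearMap.id_apply, szegoKernel]
  rw [← h'.tsum_eq]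
  refine tsum_congr fun k => ?_
  rw [smul_smul]
  congr 1
  simp [monom, mul_pow, Finset.prod_mul_distrib]

end Functions

section Shift

variable {n : ℕ} {E : Type*} [NormedAddCommGroup E]

/-- The multi-index `k + eᵢ`. -/
def raise (i : Fin n) (k : Fin n → ℕ) : Fin n → ℕ := k + Pi.single i 1

lemma raise_injective (i : Fin n) : Function.Injective (raise i) :=
  fun _ _ h => add_right_cancel h

lemma monom_raise (z : Fin n → ℂ) (i : Fin n) (k : Fin n → ℕ) :
    monom z (raise i k) = z i * monom z k := by
  simp only [monom, raise, Pi.add_apply, pow_add, Finset.prod_mul_distrib]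
  rw [mul_comm]
  congr 1
  rw [Finset.prod_eq_single i] <;> simp +contextual

/-- The coefficients of `zᵢ f`: the coefficient of `zᵢ f` at `k + eᵢ` is that of `f` at `k`, and
the coefficients at the remaining multi-indices vanish. -/
def shiftCoeff (i : Fin n) (a : (Fin n → ℕ) → E) : (Fin n → ℕ) → E :=
  Function.extend (raise i) a 0

lemma shiftCoeff_raise (i : Fin n) (a : (Fin n → ℕ) → E) (k : Fin n → ℕ) :
    shiftCoeff i a (raise i k) = a k :=
  (raise_injective i).extend_apply _ _ _

lemma shiftCoeff_of_notMem (i : Fin n) (a : (Fin n → ℕ) → E) {k : Fin n → ℕ}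
    (hk : k ∉ Set.range (raise i)) : shiftCoeff i a k = 0 :=
  Function.extend_apply' _ _ _ hk

variable [InnerProductSpace ℂ E]

lemma hasSum_shiftCoeff (i : Fin n) (f : HardySpace n E) :
    HasSum (fun k => ‖shiftCoeff i f.coeff k‖ ^ 2) (‖f‖ ^ 2) := by
  rw [← (raise_injective i).hasSum_iff (fun k hk => by simp [shiftCoeff_of_notMem i _ hk])]
  simpa [Function.comp_def, shiftCoeff_raise] using hasSum_norm_sq f

/-- The operator `M_{zᵢ}` of multiplication by the coordinate function `zᵢ`;
see `mulCoord_apply`. -/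
def mulCoord (i : Fin n) : HardySpace n E →L[ℂ] HardySpace n E :=
  LinearMap.mkContinuous
    { toFun := fun f => HardySpace.mk (shiftCoeff i f.coeff) (hasSum_shiftCoeff i f).summable
      map_add' := fun f g => coeff_ext fun k => by
        by_cases hk : k ∈ Set.range (raise i)
        · obtain ⟨l, rfl⟩ := hk
          simp [shiftCoeff_raise]
        · simp [shiftCoeff_of_notMem i _ hk]
      map_smul' := fun c f => coeff_ext fun k => by
        by_cases hk : k ∈ Set.range (raise i)
        · obtain ⟨l, rfl⟩ := hk
          simp [shiftCoeff_raise]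
        · simp [shiftCoeff_of_notMem i _ hk] }
    1
    (fun f => by
      rw [one_mul]
      refine le_of_eq ((sq_eq_sq₀ (norm_nonneg _) (norm_nonneg _)).1 ?_)
      exact (hasSum_norm_sq _).unique (hasSum_shiftCoeff i f))

lemma coeff_mulCoord (i : Fin n) (f : HardySpace n E) (k : Fin n → ℕ) :
    (mulCoord i f).coeff k = shiftCoeff i f.coeff k := rfl

/-- `(M_{zᵢ} f)(w) = wᵢ f(w)`. -/
theorem mulCoord_apply [CompleteSpace E] (i : Fin n) (f : HardySpace n E) (w : polydisc n) :
    mulCoord i f w = w.1 i • f w := by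
  rw [apply_eq_tsum, apply_eq_tsum, ← (eval_bound f w.2).1.of_norm.tsum_const_smul]
  simp only [coeff_mulCoord]
  rw [← (raise_injective i).tsum_eq (fun k hk => by
    by_contra hk'
    exact hk (by simp [shiftCoeff_of_notMem i _ hk']))]
  simp [shiftCoeff_raise, monom_raise, smul_smul]

end Shift

section Calculus

/-- `T₁^k₁ ⋯ Tₙ^kₙ` (used for tuples of commuting operators). -/
def tuplePow {n : ℕ} {A : Type*} [Monoid A] (T : Fin n → A) (k : Fin n → ℕ) : A :=
  (List.ofFn fun i => T i ^ k i).prod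

/-- For a polynomial `p(z, w̄) = ∑ a_{kl} zᵏ w̄ˡ` (the variables `Sum.inl i` stand for `zᵢ`, the
variables `Sum.inr i` for `w̄ᵢ`) and a commuting tuple `T` of operators, the operator
`p(T, T*) = ∑ a_{kl} Tᵏ T*ˡ`, with all adjoints on the right. -/
def hereditary {n : ℕ} {H : Type*} [NormedAddCommGroup H] [InnerProductSpace ℂ H]
    [CompleteSpace H] (p : MvPolynomial (Fin n ⊕ Fin n) ℂ) (T : Fin n → H →L[ℂ] H) : H →L[ℂ] H :=
  ∑ m ∈ p.support, p.coeff m •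
    (tuplePow T (fun i => m (Sum.inl i)) *
      tuplePow (fun i => ContinuousLinearMap.adjoint (T i)) (fun i => m (Sum.inr i)))

/-- The polynomial `∏ᵢ (1 - zᵢ w̄ᵢ)`, the inverse of the Szegő kernel. -/
def szegoInv (n : ℕ) : MvPolynomial (Fin n ⊕ Fin n) ℂ :=
  ∏ i, (1 - MvPolynomial.X (Sum.inl i) * MvPolynomial.X (Sum.inr i))

theorem szegoInv_mul_szegoKernel {n : ℕ} (z w : polydisc n) :
    MvPolynomial.eval (Sum.elim z.1 fun i => conj (w.1 i)) (szegoInv n) *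
      szegoKernel z.1 w.1 = 1 := by
  rw [szegoInv, szegoKernel, map_prod, ← Finset.prod_mul_distrib]
  refine Finset.prod_eq_one fun i _ => ?_
  have h : ‖z.1 i * conj (w.1 i)‖ < 1 := by
    rw [norm_mul, RCLike.norm_conj]
    exact mul_lt_one_of_nonneg_of_lt_one_left (norm_nonneg _) (z.2 i) (w.2 i).le
  have h0 : (1 : ℂ) - z.1 i * conj (w.1 i) ≠ 0 := by
    intro h'
    rw [← sub_eq_zero.1 h'] at h
    simp at h
  simpa using mul_inv_cancel₀ h0

end Calculus

/-- A submodule of the Hardy module `H²(𝔻ⁿ) ⊗ E`: a closed subspace invariant under all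
coordinate multiplication operators. -/
structure HardySubmodule (n : ℕ) (E : Type*) [NormedAddCommGroup E] [InnerProductSpace ℂ E]
    [CompleteSpace E] where
  /-- the underlying closed subspace -/
  carrier : ClosedSubmodule ℂ (HardySpace n E)
  mulCoord_mem : ∀ (i : Fin n), ∀ f ∈ carrier.toSubmodule, mulCoord i f ∈ carrier.toSubmodule

namespace HardySubmodule

variable {n : ℕ} {E : Type*} [NormedAddCommGroup E] [InnerProductSpace ℂ E] [CompleteSpace E]

/-- The Hilbert space underlying a submodule. -/
abbrev space (S : HardySubmodule n E) : Submodule ℂ (HardySpace n E) := S.carrier.toSubmodule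

instance (S : HardySubmodule n E) : CompleteSpace S.space :=
  inferInstanceAs (CompleteSpace S.carrier)

/-- The restriction `R_{zᵢ} = M_{zᵢ}|_S`, as an operator on `S`. -/
def R (S : HardySubmodule n E) (i : Fin n) : S.space →L[ℂ] S.space :=
  (mulCoord i).restrict (S.mulCoord_mem i)

/-- `S` is a Brehmer submodule: `g⁻¹(R_z, R_z*) ≥ 0`, where `g` is the Szegő kernel. -/
def IsBrehmer (S : HardySubmodule n E) : Prop :=
  (hereditary (szegoInv n) S.R).IsPositive

/-- `S` is doubly commuting: `R_{zᵢ}* R_{zⱼ} - R_{zⱼ} R_{zᵢ}* = 0` for all `i ≠ j`. -/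
def IsDoublyCommuting (S : HardySubmodule n E) : Prop :=
  ∀ i j : Fin n, i ≠ j →
    ContinuousLinearMap.adjoint (S.R i) * S.R j - S.R j * ContinuousLinearMap.adjoint (S.R i) = 0

end HardySubmodule

end PolydiscHardy

end

/-!
The restrictions `R i` form a commuting tuple of isometries, and `(R i)* ^ m → 0` strongly because
the coefficients of an element of `H²` at the multi-indices `k` with `m ≤ k i` form the tail of a
square summable family. The theorem holds for any such tuple `T` of operators on a Hilbert space.

For a set `s` of coordinates put `D s = ∑_{F ⊆ s} (-1)^|F| T_F T_F*`, the hereditary calculus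
applied to `∏_{i ∈ s} (1 - zᵢ w̄ᵢ)`. It satisfies `D (s ∪ {k}) = D s - T k * D s * (T k)*`
(`hereditary_szegoFactor_insert`), so `0 ≤ D (s ∪ {k})` says that `D s` dominates
`T k * D s * (T k)*`. Iterating, `D s` dominates `(T k)^m * D s * (T k)* ^ m`, which tends to `0`
weakly; hence `0 ≤ D s` (`re_inner_nonneg_of_sub_conj_nonneg`). If `D` is positive on the full set
of coordinates, it is therefore positive on every pair:
`0 ≤ P - T j * P * (T j)*` with the projection `P = 1 - T i * (T i)*`. Evaluated on the range of
`T i`, where `P` vanishes, this forces `P * (T j)* * T i = 0`, which is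
`(T j)* * T i = T i * (T j)*` (`adjoint_mul_comm_of_pair_nonneg`).

Conversely, for a doubly commuting tuple `D s` commutes with `T k` and `(T k)*` for `k ∉ s`, so
`D (s ∪ {k})` is the compression of `D s` by the projection `1 - T k * (T k)*`, and positivity
follows by induction.
-/

noncomputable section

namespace PolydiscHardy

open scoped InnerProductSpace ComplexConjugate ENNReal
open Filter Topology ContinuousLinearMap

/-! ### Powers of commuting tuples -/

section TuplePow

variable {A : Type*} [Monoid A]

lemma tuplePow_succ {n : ℕ} (T : Fin (n + 1) → A) (k : Fin (n + 1) → ℕ) :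
    tuplePow T k = T 0 ^ k 0 * tuplePow (fun i => T i.succ) (fun i => k i.succ) := by
  simp [tuplePow, List.ofFn_succ]

lemma tuplePow_zero {n : ℕ} (T : Fin n → A) : tuplePow T (fun _ => 0) = 1 := by
  induction n with
  | zero => simp [tuplePow]
  | succ n ih => rw [tuplePow_succ, ih, pow_zero, one_mul]

lemma commute_tuplePow {n : ℕ} {T : Fin n → A} {a : A} (h : ∀ i, Commute a (T i))
    (k : Fin n → ℕ) : Commute a (tuplePow T k) := by
  refine Commute.list_prod_right _ _ fun b hb => ?_
  obtain ⟨i, rfl⟩ := (List.mem_ofFn' _ _).1 hb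
  exact (h i).pow_right _

lemma tuplePow_add_single {n : ℕ} {T : Fin n → A} (h : ∀ i j, Commute (T i) (T j))
    (k : Fin n → ℕ) (j : Fin n) : tuplePow T (k + Pi.single j 1) = T j * tuplePow T k := by
  induction n with
  | zero => exact j.elim0
  | succ n ih =>
    rw [tuplePow_succ, tuplePow_succ]
    refine Fin.cases ?_ (fun j => ?_) j
    · simp [pow_succ', mul_assoc]
    · have hk : (fun i : Fin n => (k + Pi.single j.succ 1 : Fin (n + 1) → ℕ) i.succ) =
          (fun i => k i.succ) + Pi.single j 1 := by
        ext i
        simp [Pi.single_apply]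
      rw [hk, ih (fun i j => h _ _)]
      have h0 : (k + Pi.single j.succ 1 : Fin (n + 1) → ℕ) 0 = k 0 := by simp
      rw [h0, ← mul_assoc, ← mul_assoc, ((h j.succ 0).pow_right _).eq]

end TuplePow

/-! ### The hereditary calculus -/

section Hereditary

variable {n : ℕ} {H : Type*} [NormedAddCommGroup H] [InnerProductSpace ℂ H] [CompleteSpace H]

/-- The value of the hereditary calculus at the monomial `zᵏ w̄ˡ`. -/
def hereditaryMonomial (T : Fin n → H →L[ℂ] H) (m : Fin n ⊕ Fin n →₀ ℕ) : H →L[ℂ] H :=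
  tuplePow T (fun i => m (Sum.inl i)) * tuplePow (fun i => adjoint (T i)) (fun i => m (Sum.inr i))

/-- The hereditary calculus `p ↦ p(T, T*)` as a linear map. -/
def hereditaryLin (T : Fin n → H →L[ℂ] H) :
    MvPolynomial (Fin n ⊕ Fin n) ℂ →ₗ[ℂ] H →L[ℂ] H :=
  (MvPolynomial.basisMonomials _ ℂ).constr ℂ (hereditaryMonomial T)

lemma hereditaryLin_monomial (T : Fin n → H →L[ℂ] H) (m : Fin n ⊕ Fin n →₀ ℕ) (c : ℂ) :
    hereditaryLin T (MvPolynomial.monomial m c) = c • hereditaryMonomial T m := by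
  have h : MvPolynomial.monomial m c = c • MvPolynomial.basisMonomials (Fin n ⊕ Fin n) ℂ m := by
    simp [MvPolynomial.smul_monomial]
  rw [h, map_smul, hereditaryLin, Module.Basis.constr_basis]

lemma hereditary_eq_hereditaryLin (p : MvPolynomial (Fin n ⊕ Fin n) ℂ) (T : Fin n → H →L[ℂ] H) :
    hereditary p T = hereditaryLin T p := by
  conv_rhs => rw [p.as_sum, map_sum]
  exact Finset.sum_congr rfl fun m _ => (hereditaryLin_monomial T m _).symm

lemma hereditaryLin_one (T : Fin n → H →L[ℂ] H) : hereditaryLin T 1 = 1 := by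
  have h := hereditaryLin_monomial T 0 1
  rw [one_smul] at h
  refine h.trans ?_
  simp [hereditaryMonomial, tuplePow_zero]

/-- Multiplying the symbol by `zⱼ w̄ⱼ` conjugates the operator by `T j`: holomorphic variables act
from the left, antiholomorphic ones from the right. -/
lemma hereditaryLin_X_mul_X_mul {T : Fin n → H →L[ℂ] H} (h : ∀ i j, Commute (T i) (T j))
    (j : Fin n) (p : MvPolynomial (Fin n ⊕ Fin n) ℂ) :
    hereditaryLin T (MvPolynomial.X (Sum.inl j) * MvPolynomial.X (Sum.inr j) * p) =
      T j * hereditaryLin T p * adjoint (T j) := by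
  have h' : ∀ i j, Commute (adjoint (T i)) (adjoint (T j)) := fun i j => (h i j).star_star
  induction p using MvPolynomial.induction_on' with
  | monomial m c =>
    have hm : (MvPolynomial.X (Sum.inl j) * MvPolynomial.X (Sum.inr j) *
        MvPolynomial.monomial m c : MvPolynomial (Fin n ⊕ Fin n) ℂ) =
        MvPolynomial.monomial
          (Finsupp.single (Sum.inl j) 1 + Finsupp.single (Sum.inr j) 1 + m) c := by
      simp [MvPolynomial.X, MvPolynomial.monomial_mul]
    have hl : (fun i => (Finsupp.single (Sum.inl j) 1 + Finsupp.single (Sum.inr j) 1 + m :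
        Fin n ⊕ Fin n →₀ ℕ) (Sum.inl i)) = (fun i => m (Sum.inl i)) + Pi.single j 1 := by
      ext i
      simp [Finsupp.single_apply, Pi.single_apply, add_comm, eq_comm]
    have hr : (fun i => (Finsupp.single (Sum.inl j) 1 + Finsupp.single (Sum.inr j) 1 + m :
        Fin n ⊕ Fin n →₀ ℕ) (Sum.inr i)) = (fun i => m (Sum.inr i)) + Pi.single j 1 := by
      ext i
      simp [Finsupp.single_apply, Pi.single_apply, add_comm, eq_comm]
    rw [hm, hereditaryLin_monomial, hereditaryLin_monomial, hereditaryMonomial,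
      hereditaryMonomial, hl, hr, tuplePow_add_single h, tuplePow_add_single h',
      (commute_tuplePow (h' j) _).eq, mul_smul_comm, smul_mul_assoc]
    simp only [mul_assoc]
  | add p q hp hq => rw [mul_add, map_add, map_add, hp, hq, mul_add, add_mul]

/-- The factor `∏_{i ∈ s} (1 - zᵢ w̄ᵢ)` of the inverse Szegő kernel. -/
def szegoFactor (s : Finset (Fin n)) : MvPolynomial (Fin n ⊕ Fin n) ℂ :=
  ∏ i ∈ s, (1 - MvPolynomial.X (Sum.inl i) * MvPolynomial.X (Sum.inr i))

lemma hereditary_szegoFactor_empty (T : Fin n → H →L[ℂ] H) :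
    hereditary (szegoFactor ∅) T = 1 := by
  rw [hereditary_eq_hereditaryLin, szegoFactor, Finset.prod_empty, hereditaryLin_one]

lemma hereditary_szegoFactor_insert {T : Fin n → H →L[ℂ] H} (h : ∀ i j, Commute (T i) (T j))
    {s : Finset (Fin n)} {k : Fin n} (hk : k ∉ s) :
    hereditary (szegoFactor (insert k s)) T =
      hereditary (szegoFactor s) T - T k * hereditary (szegoFactor s) T * adjoint (T k) := by
  simp only [hereditary_eq_hereditaryLin]
  rw [szegoFactor, Finset.prod_insert hk, sub_mul, one_mul, map_sub,
    hereditaryLin_X_mul_X_mul h]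
  rfl

end Hereditary

/-! ### Commuting isometries with strongly vanishing adjoint powers -/

section Isometries

variable {n : ℕ} {H : Type*} [NormedAddCommGroup H] [InnerProductSpace ℂ H] [CompleteSpace H]

/-- If `D` dominates `V * D * V*` and the powers of `V*` tend to `0` strongly, then `0 ≤ D`. -/
lemma re_inner_nonneg_of_sub_conj_nonneg {V D : H →L[ℂ] H}
    (hV : ∀ x, Tendsto (fun m : ℕ => (adjoint V ^ m) x) atTop (𝓝 0))
    (hD : ∀ x, 0 ≤ (⟪(D - V * D * adjoint V) x, x⟫_ℂ).re) (x : H) :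
    0 ≤ (⟪D x, x⟫_ℂ).re := by
  have hle : ∀ m : ℕ, (⟪D ((adjoint V ^ m) x), (adjoint V ^ m) x⟫_ℂ).re ≤ (⟪D x, x⟫_ℂ).re := by
    intro m
    induction m with
    | zero => simp
    | succ m ih =>
      refine le_trans ?_ ih
      have h := hD ((adjoint V ^ m) x)
      rw [sub_apply, inner_sub_left, Complex.sub_re, mul_apply_eq_comp, mul_apply_eq_comp,
        ← adjoint_inner_right V, sub_nonneg] at h
      rwa [pow_succ', mul_apply_eq_comp]
  have hlim : Tendsto (fun m : ℕ => (⟪D ((adjoint V ^ m) x), (adjoint V ^ m) x⟫_ℂ).re) atTop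
      (𝓝 0) := by
    have := Complex.continuous_re.continuousAt.tendsto.comp
      (((D.continuous.tendsto 0).comp (hV x)).inner (hV x))
    simpa [Function.comp_def] using this
  exact le_of_tendsto' hlim hle

/-- Positivity of `D` on a pair of coordinates makes `V*` commute with `U`. -/
lemma adjoint_mul_comm_of_pair_nonneg {U V : H →L[ℂ] H} (hUV : Commute U V)
    (hU : adjoint U * U = 1)
    (h : ∀ x, 0 ≤ (⟪((1 - U * adjoint U) - V * (1 - U * adjoint U) * adjoint V) x, x⟫_ℂ).re) :
    adjoint V * U = U * adjoint V := by
  have hUU : ∀ y, adjoint U (U y) = y := fun y => congrArg (fun f : H →L[ℂ] H => f y) hU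
  ext y
  set z := adjoint V (U y) with hz
  have hw : adjoint U z = adjoint V y := by
    have := congrArg (fun f : H →L[ℂ] H => f (U y)) hUV.star_star.eq
    simp only [mul_apply_eq_comp, star_eq_adjoint, hUU] at this
    exact this
  have h1 := h (U y)
  -- `1 - U U*` vanishes at `U y`, so the form at `U y` is `-⟪(1 - U U*) z, z⟫ = -‖z - U U* z‖²`.
  have h2 : ⟪((1 - U * adjoint U) - V * (1 - U * adjoint U) * adjoint V) (U y), U y⟫_ℂ =
      -⟪z - U (adjoint U z), z⟫_ℂ := by
    simp only [sub_apply, mul_apply_eq_comp, one_apply_eq_self, hUU, sub_self, zero_sub,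
      inner_neg_left, ← hz]
    rw [← adjoint_inner_right, ← hz]
  have h3 : ⟪z - U (adjoint U z), U (adjoint U z)⟫_ℂ = 0 := by
    rw [← adjoint_inner_left, map_sub, hUU, sub_self, inner_zero_left]
  have h4 : ⟪z - U (adjoint U z), z⟫_ℂ = ⟪z - U (adjoint U z), z - U (adjoint U z)⟫_ℂ := by
    rw [inner_sub_right _ z, h3, sub_zero]
  rw [h2, h4, inner_self_eq_norm_sq_to_K] at h1
  have h5 : ‖z - U (adjoint U z)‖ ^ 2 ≤ 0 := by
    have : (-((‖z - U (adjoint U z)‖ : ℂ) ^ 2)).re = -‖z - U (adjoint U z)‖ ^ 2 := by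
      rw [← Complex.ofReal_pow, Complex.neg_re, Complex.ofReal_re]
    have h6 := this ▸ h1
    linarith
  have h6 : z = U (adjoint U z) :=
    sub_eq_zero.1 (norm_eq_zero.1 (pow_eq_zero_iff two_ne_zero |>.1
      (le_antisymm h5 (sq_nonneg _))))
  rw [mul_apply_eq_comp, mul_apply_eq_comp, ← hz, h6, hw]

/-- Positivity of `D` passes from a set of coordinates to its subsets. -/
lemma re_inner_szegoFactor_nonneg_of_union {T : Fin n → H →L[ℂ] H}
    (hc : ∀ i j, Commute (T i) (T j))
    (hp : ∀ i x, Tendsto (fun m : ℕ => (adjoint (T i) ^ m) x) atTop (𝓝 0))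
    (s t : Finset (Fin n))
    (h : ∀ x, 0 ≤ (⟪hereditary (szegoFactor (t ∪ s)) T x, x⟫_ℂ).re) (x : H) :
    0 ≤ (⟪hereditary (szegoFactor s) T x, x⟫_ℂ).re := by
  induction t using Finset.induction_on with
  | empty => simpa using h x
  | insert k t _ ih =>
    refine ih ?_
    rw [Finset.insert_union] at h
    by_cases hk : k ∈ t ∪ s
    · rwa [Finset.insert_eq_of_mem hk] at h
    · rw [hereditary_szegoFactor_insert hc hk] at h
      exact re_inner_nonneg_of_sub_conj_nonneg (hp k) h

theorem doublyCommuting_of_hereditary_szegoInv_nonneg {T : Fin n → H →L[ℂ] H}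
    (hc : ∀ i j, Commute (T i) (T j)) (hi : ∀ i, adjoint (T i) * T i = 1)
    (hp : ∀ i x, Tendsto (fun m : ℕ => (adjoint (T i) ^ m) x) atTop (𝓝 0))
    (h : (hereditary (szegoInv n) T).IsPositive) {i j : Fin n} (hij : i ≠ j) :
    adjoint (T i) * T j = T j * adjoint (T i) := by
  refine adjoint_mul_comm_of_pair_nonneg (hc j i) (hi j) fun x => ?_
  have h1 := re_inner_szegoFactor_nonneg_of_union hc hp {i, j} Finset.univ
    (by
      rw [Finset.union_eq_left.2 (Finset.subset_univ _)]
      exact h.re_inner_nonneg_left) x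
  rw [hereditary_szegoFactor_insert hc (by simpa using hij), ← insert_empty_eq j,
    hereditary_szegoFactor_insert hc (Finset.notMem_empty j), hereditary_szegoFactor_empty,
    mul_one] at h1
  exact h1

theorem hereditary_szegoInv_isPositive_of_doublyCommuting {T : Fin n → H →L[ℂ] H}
    (hc : ∀ i j, Commute (T i) (T j)) (hi : ∀ i, adjoint (T i) * T i = 1)
    (hd : ∀ i j, i ≠ j → adjoint (T i) * T j = T j * adjoint (T i)) :
    (hereditary (szegoInv n) T).IsPositive := by
  suffices key : ∀ s : Finset (Fin n), (hereditary (szegoFactor s) T).IsPositive ∧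
      ∀ k ∉ s, Commute (T k) (hereditary (szegoFactor s) T) ∧
        Commute (adjoint (T k)) (hereditary (szegoFactor s) T) from (key Finset.univ).1
  intro s
  induction s using Finset.induction_on with
  | empty =>
    rw [hereditary_szegoFactor_empty]
    exact ⟨isPositive_one, fun k _ => ⟨Commute.one_right _, Commute.one_right _⟩⟩
  | insert j s hj ih =>
    obtain ⟨hpos, hcomm⟩ := ih
    rw [hereditary_szegoFactor_insert hc hj]
    set D := hereditary (szegoFactor s) T
    set P := 1 - T j * adjoint (T j) with hP
    have hPsa : adjoint P = P := by
      simp only [← star_eq_adjoint, hP, star_sub, star_one, star_mul, star_star]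
    have hPP : P * P = P := by
      have : T j * adjoint (T j) * (T j * adjoint (T j)) = T j * adjoint (T j) := by
        rw [mul_assoc, ← mul_assoc (adjoint (T j)), hi, one_mul]
      rw [hP, mul_sub, sub_mul, sub_mul, this]
      simp
    have hPD : Commute P D :=
      (Commute.one_left _).sub_left ((hcomm j hj).1.mul_left (hcomm j hj).2)
    have hD : D - T j * D * adjoint (T j) = P * D * P := by
      rw [hPD.eq, mul_assoc D, hPP, ← hPD.eq, hP, sub_mul, one_mul, mul_assoc, mul_assoc,
        (hcomm j hj).2.eq]
    refine ⟨?_, fun k hk => ?_⟩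
    · rw [hD]
      have := hpos.conj_adjoint P
      rwa [hPsa] at this
    · rw [Finset.mem_insert, not_or] at hk
      obtain ⟨h1, h2⟩ := hcomm k hk.2
      have h3 : Commute (T k) (adjoint (T j)) := (hd j k (Ne.symm hk.1)).symm
      have h4 : Commute (adjoint (T k)) (T j) := hd k j hk.1
      have h5 : Commute (adjoint (T k)) (adjoint (T j)) := (hc k j).star_star
      exact ⟨h1.sub_right (((hc k j).mul_right h1).mul_right h3),
        h2.sub_right ((h4.mul_right h2).mul_right h5)⟩

end Isometries

/-! ### Submodules of the Hardy space -/

section Submodules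

variable {n : ℕ} {E : Type*} [NormedAddCommGroup E] [InnerProductSpace ℂ E]

lemma norm_mulCoord (i : Fin n) (f : HardySpace n E) : ‖mulCoord i f‖ = ‖f‖ :=
  (sq_eq_sq₀ (norm_nonneg _) (norm_nonneg _)).1
    ((hasSum_norm_sq _).unique (hasSum_shiftCoeff i f))

lemma mulCoord_pow_coeff_eq_zero (i : Fin n) (f : HardySpace n E) {m : ℕ} {k : Fin n → ℕ}
    (hk : k i < m) : ((mulCoord i ^ m) f).coeff k = 0 := by
  induction m generalizing k with
  | zero => omega
  | succ m ih =>
    rw [pow_succ', mul_apply_eq_comp, coeff_mulCoord]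
    by_cases hr : k ∈ Set.range (raise i)
    · obtain ⟨l, rfl⟩ := hr
      rw [shiftCoeff_raise]
      refine ih ?_
      simpa [raise] using hk
    · exact shiftCoeff_of_notMem i _ hr

lemma commute_mulCoord [CompleteSpace E] (i j : Fin n) :
    Commute (mulCoord i : HardySpace n E →L[ℂ] HardySpace n E) (mulCoord j) := by
  refine ContinuousLinearMap.ext fun f => RKHS.coeCLM_injective (𝕜 := ℂ) (funext fun w => ?_)
  change (mulCoord i (mulCoord j f)) w = (mulCoord j (mulCoord i f)) w
  simp only [mulCoord_apply, smul_smul, mul_comm]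

/-- The part of a series supported on the multi-indices `k` with `m ≤ k i`. -/
def coordTail (i : Fin n) (f : HardySpace n E) (m : ℕ) : HardySpace n E :=
  HardySpace.mk (fun k => if m ≤ k i then f.coeff k else 0)
    ((hasSum_norm_sq f).summable.of_nonneg_of_le (fun _ => by positivity) fun k => by
      split_ifs <;> simp)

lemma tendsto_norm_coordTail (i : Fin n) (f : HardySpace n E) :
    Tendsto (fun m => ‖coordTail i f m‖) atTop (𝓝 0) := by
  have h : Tendsto (fun m => ‖coordTail i f m‖ ^ 2) atTop (𝓝 0) := by
    have := tendsto_tsum_of_dominated_convergence (𝓕 := atTop)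
      (f := fun m k => ‖(coordTail i f m).coeff k‖ ^ 2) (g := fun _ => (0 : ℝ))
      (hasSum_norm_sq f).summable
      (fun k => by
        refine tendsto_const_nhds.congr' ?_
        filter_upwards [eventually_gt_atTop (k i)] with m hm
        simp [coordTail, not_le.2 hm])
      (Eventually.of_forall fun m k => by
        rw [coordTail, coeff_mk]
        split_ifs <;> simp)
    simpa only [(hasSum_norm_sq _).tsum_eq, tsum_zero] using this
  simpa using h.sqrt

namespace HardySubmodule

variable [CompleteSpace E] (S : HardySubmodule n E)

lemma commute_R (i j : Fin n) : Commute (S.R i) (S.R j) := by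
  refine ContinuousLinearMap.ext fun f => Subtype.ext ?_
  exact congrArg (fun T : HardySpace n E →L[ℂ] HardySpace n E => T f) (commute_mulCoord i j).eq

lemma adjoint_R_mul_R (i : Fin n) : adjoint (S.R i) * S.R i = 1 :=
  norm_map_iff_adjoint_comp_self _ |>.1 fun f => norm_mulCoord i (f : HardySpace n E)

lemma coe_R_pow (i : Fin n) (m : ℕ) (f : S.space) :
    ((S.R i ^ m) f : HardySpace n E) = (mulCoord i ^ m) (f : HardySpace n E) := by
  induction m with
  | zero => rfl
  | succ m ih =>
    rw [pow_succ', pow_succ', mul_apply_eq_comp, mul_apply_eq_comp, ← ih]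
    rfl

/-- As `R^m` maps into the series supported on `m ≤ k i`, the norm of `R* ^ m f` is controlled by
the tail of `f` on these multi-indices. -/
lemma norm_adjoint_R_pow_le (i : Fin n) (m : ℕ) (f : S.space) :
    ‖(adjoint (S.R i) ^ m) f‖ ≤ ‖coordTail i (f : HardySpace n E) m‖ := by
  obtain ⟨y, hy⟩ : ∃ y, y = (adjoint (S.R i) ^ m) f := ⟨_, rfl⟩
  rw [← hy]
  have hadj : adjoint (S.R i ^ m) f = y := by
    rw [hy, ← star_eq_adjoint, star_pow, star_eq_adjoint]
  have hnorm : ‖((S.R i ^ m) y : HardySpace n E)‖ = ‖y‖ := by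
    rw [coe_R_pow]
    clear hadj hy
    induction m with
    | zero => rfl
    | succ m ih => rw [pow_succ', mul_apply_eq_comp, norm_mulCoord, ih]
  have hinner : ⟪y, y⟫_ℂ =
      ⟪((S.R i ^ m) y : HardySpace n E), coordTail i (f : HardySpace n E) m⟫_ℂ := by
    have h1 : ⟪y, y⟫_ℂ = ⟪((S.R i ^ m) y : HardySpace n E), (f : HardySpace n E)⟫_ℂ := by
      conv_lhs => rw [← hadj, adjoint_inner_right, hadj]
      rfl
    rw [h1, inner_eq_tsum, inner_eq_tsum]
    refine tsum_congr fun k => ?_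
    rw [coordTail, coeff_mk]
    split_ifs with hk
    · rfl
    · rw [coe_R_pow, mulCoord_pow_coeff_eq_zero i _ (not_le.1 hk), inner_zero_left,
        inner_zero_left]
  have hle : ‖y‖ * ‖y‖ ≤ ‖y‖ * ‖coordTail i (f : HardySpace n E) m‖ := by
    rw [← inner_self_eq_norm_mul_norm (𝕜 := ℂ) y, hinner, ← hnorm]
    exact re_inner_le_norm _ _
  rcases (norm_nonneg y).eq_or_lt with h0 | h0
  · rw [← h0]
    exact norm_nonneg _
  · exact le_of_mul_le_mul_left hle h0

lemma tendsto_adjoint_R_pow (i : Fin n) (f : S.space) :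
    Tendsto (fun m : ℕ => (adjoint (S.R i) ^ m) f) atTop (𝓝 0) :=
  squeeze_zero_norm (fun m => S.norm_adjoint_R_pow_le i m f)
    (tendsto_norm_coordTail i (f : HardySpace n E))

end HardySubmodule

end Submodules

end PolydiscHardy

end

theorem mainTheorem4 (n : ℕ) (hn : 2 ≤ n) (E : Type*) [NormedAddCommGroup E]
    [InnerProductSpace ℂ E] [CompleteSpace E] (S : PolydiscHardy.HardySubmodule n E) :
    S.IsBrehmer ↔ S.IsDoublyCommuting := by
  constructor
  · intro h i j hij
    exact sub_eq_zero.2 (PolydiscHardy.doublyCommuting_of_hereditary_szegoInv_nonneg S.commute_R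
      S.adjoint_R_mul_R S.tendsto_adjoint_R_pow h hij)
  · intro h
    exact PolydiscHardy.hereditary_szegoInv_isPositive_of_doublyCommuting S.commute_R
      S.adjoint_R_mul_R fun i j hij => sub_eq_zero.1 (h i j hij)
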